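/- Let $X$ be a $\sigma$-compact metric space with its Borel $\sigma$-algebra, and let $\sigma$ be a diffuse (i.e. $\sigma(\{x\})=0$ for every $x\in X$), $\sigma$-finite Borel measure on $X$ that is finite on compact sets. Let $\Omega^X$ be the space of at most countable, locally finite subsets $\omega$ of $X$, each identified with the point measure $\omega=\sum_{x\in\omega}\epsilon_x$, where $\epsilon_x$ is the Dirac measure at $x$; equip $\Omega^X$ with the $\sigma$-algebra generated by the maps $\omega\mapsto\omega(A)$, $A\subset X$ Borel. Let $\pi_\sigma$ be the Poisson probability measure on $\Omega^X$ with intensity $\sigma$, i.e. for all disjoint compact sets $A_1,\dots,A_m\subset X$ the random variables $\omega(A_1),\dots,\omega(A_m)$ are independent and Poisson distributed with respective means $\sigma(A_1),\dots,\sigma(A_m)$; write $E$ for the expectation under $\pi_\sigma$. Let $f:X\to\mathbb{R}$ be a bounded measurable (deterministic) function with compact support, and write $\int_X f(x)\,(\omega(dx)-\sigma(dx)) := \int_X f\,d\omega-\int_X f\,d\sigma$. Then for every integer $n\ge 1$ the random variable $\big(\int_X f(x)\,(\omega(dx)-\sigma(dx))\big)^n$ is integrable, and $$ E\left[\left(\int_X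 f(x)\,(\omega(dx)-\sigma(dx))\right)^n\right] =\sum_{\substack{\{P_1,\dots,P_k\}\\ |P_1|\ge 2,\dots,|P_k|\ge 2}} \int_X f^{|P_1|}(x)\,\sigma(dx)\cdots\int_X f^{|P_k|}(x)\,\sigma(dx), $$ where the sum runs over all (unordered) partitions $\{P_1,\dots,P_k\}$ of $\{1,\dots,n\}$ into nonempty blocks all of which have cardinality at least $2$ (for $n=1$ the sum is empty and equals $0$). -/

import Mathlib

open MeasureTheory ProbabilityTheory Topology
open scoped ENNReal NNReal

/-- The configuration space over `X`: at most countable, locally finite subsets of `X`. -/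
structure PointConfiguration (X : Type*) [TopologicalSpace X] where
  carrier : Set X
  countable : carrier.Countable
  locallyFinite : ∀ x : X, ∃ U ∈ 𝓝 x, (U ∩ carrier).Finite

namespace PointConfiguration

/-- The point measure `∑_{x ∈ ω} δ_x` with which a configuration `ω` is identified. -/
noncomputable def toMeasure {X : Type*} [TopologicalSpace X] [MeasurableSpace X]
    (ω : PointConfiguration X) : Measure X :=
  Measure.sum fun x : ω.carrier => Measure.dirac (x : X)

/-- The usual sigma-algebra on the configuration space: the smallest one for which all the
counting maps `ω ↦ ω(A)`, with `A` measurable, are measurable. -/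
noncomputable instance instMeasurableSpace {X : Type*} [TopologicalSpace X] [MeasurableSpace X] :
    MeasurableSpace (PointConfiguration X) :=
  MeasurableSpace.comap toMeasure inferInstance

/-- The compensated Poisson integral `∫ f(x) (ω(dx) - σ(dx))`. -/
noncomputable def compensatedIntegral {X : Type*} [TopologicalSpace X] [MeasurableSpace X]
    (σ : Measure X) (f : X → ℝ) (ω : PointConfiguration X) : ℝ :=
  ∫ x, f x ∂ω.toMeasure - ∫ x, f x ∂σ

end PointConfiguration

/-- `π` is the Poisson probability measure with intensity `σ` on the configuration space: for
disjoint compact sets `A₁, …, Aₘ`, the counts `ω(A₁), …, ω(Aₘ)` are independent and Poisson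
distributed, with means `σ(A₁), …, σ(Aₘ)`. The counts take values in `ℝ≥0∞`, hence the Poisson
law on `ℕ` is transported along the inclusion of `ℕ`. The measure `σ` is meant to be finite on
compact sets. -/
structure IsPoissonMeasure {X : Type*} [TopologicalSpace X] [MeasurableSpace X]
    (σ : Measure X) (π : Measure (PointConfiguration X)) : Prop where
  isProbabilityMeasure : IsProbabilityMeasure π
  hasLaw_count : ∀ A : Set X, IsCompact A →
    HasLaw (fun ω : PointConfiguration X => ω.toMeasure A)
      ((poissonMeasure (σ A).toNNReal).map (fun k : ℕ => (k : ℝ≥0∞))) π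
  iIndepFun_count : ∀ (m : ℕ) (A : Fin m → Set X), (∀ i, IsCompact (A i)) →
    Pairwise (fun i j => Disjoint (A i) (A j)) →
    iIndepFun (fun i (ω : PointConfiguration X) => ω.toMeasure (A i)) π

/-! ### Set partitions and the moment-cumulant recursion -/

section

open Finset

/-! The compensated integral `S` has an explicit moment generating function, `E[exp (t S)] = exp (G
t)` with `G t = ∫ (exp (t f) - 1 - t f) dσ`. All exponential moments are finite, so the moments of
`S` are the derivatives of `exp ∘ G` at 0. Faà di Bruno's formula (`iteratedDeriv_exp_comp`) writes
them as sums over set partitions of products of cumulants `G⁽ᵏ⁾(0)`. These equal `∫ f ^ k dσ` for `k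
≥ 2`, and compensation makes the first one vanish, which kills every partition with a singleton
block.

The formula for `E[exp (t S)]` rests on the Laplace functional (`IsPoissonMeasure.laplace`). It
follows from independence for step functions on disjoint compact sets, and passes to bounded
functions supported in a compact set by dominated convergence. -/

theorem Finpartition.sum_prod_card_insert {α : Type*} [DecidableEq α] (κ : ℕ → ℝ) {a : α}
    {s : Finset α} (ha : a ∉ s) :
    ∑ P : Finpartition (insert a s), ∏ B ∈ P.parts, κ #B =
      ∑ t ∈ s.powerset, κ (#t + 1) * ∑ Q : Finpartition (s \ t), ∏ B ∈ Q.parts, κ #B := by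
  simp_rw [Finset.mul_sum]
  rw [Finset.sum_sigma']
  symm
  have hb (t : Finset α) : insert a t ≠ (⊥ : Finset α) := (insert_nonempty a t).ne_empty
  have hd (t : Finset α) : Disjoint (s \ t) (insert a t) := by
    rw [disjoint_insert_right]
    exact ⟨fun h => ha (mem_sdiff.1 h).1, sdiff_disjoint⟩
  have hc (t : Finset α) (ht : t ∈ s.powerset) : (s \ t) ⊔ insert a t = insert a s := by
    rw [sup_eq_union, union_insert, sdiff_union_of_subset (mem_powerset.1 ht)]
  have hn (t : Finset α) (Q : Finpartition (s \ t)) (B : Finset α) (hB : B ∈ Q.parts) : a ∉ B :=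
    fun h => ha (mem_sdiff.1 (Q.subset hB h)).1
  -- A partition of `insert a s` amounts to the block `insert a t` containing `a` together with a
  -- partition of `s \ t`.
  refine Finset.sum_bij
    (fun p hp => p.2.extend (hb p.1) (hd p.1) (hc p.1 (mem_sigma.1 hp).1))
    (fun _ _ => mem_univ _) ?_ ?_ ?_
  · rintro ⟨t, Q⟩ ht ⟨t', Q'⟩ ht' h
    replace h := congrArg Finpartition.parts h
    simp only [Finpartition.extend_parts] at h
    simp only [mem_sigma, mem_powerset, mem_univ, and_true] at ht ht'
    have h1 : insert a t = insert a t' := by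
      have : insert a t ∈ insert (insert a t') Q'.parts := h ▸ mem_insert_self _ _
      rcases mem_insert.1 this with h2 | h2
      · exact h2
      · exact absurd (mem_insert_self a t) (hn t' Q' _ h2)
    obtain rfl : t = t' := by
      rw [← erase_insert (fun h => ha (ht h)), h1, erase_insert (fun h => ha (ht' h))]
    obtain rfl : Q = Q' := by
      ext1
      rw [← erase_insert (fun h => hn t Q _ h (mem_insert_self a t)), h,
        erase_insert (fun h => hn t Q' _ h (mem_insert_self a t))]
    rfl
  · intro P _
    have haP : P.part a ∈ P.parts := P.part_mem.2 (mem_insert_self a s)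
    have haa : a ∈ P.part a := P.mem_part_self.2 (mem_insert_self a s)
    have hsub : (P.part a).erase a ⊆ s := subset_insert_iff.1 (P.part_subset a)
    have hsup : (P.parts.erase (P.part a)).sup id = s \ (P.part a).erase a := by
      ext x
      simp only [mem_sup, mem_erase, id, mem_sdiff, not_and]
      refine ⟨fun ⟨B, ⟨hBa, hB⟩, hx⟩ => ?_, fun ⟨hx, hxa⟩ => ?_⟩
      · have hxB : x ∉ P.part a := fun h => hBa (P.eq_of_mem_parts hB haP hx h)
        refine ⟨(mem_insert.1 (P.subset hB hx)).resolve_left ?_, fun _ => hxB⟩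
        rintro rfl
        exact hxB haa
      · refine ⟨P.part x, ⟨fun h => ?_, P.part_mem.2 (mem_insert_of_mem hx)⟩,
          P.mem_part_self.2 (mem_insert_of_mem hx)⟩
        exact hxa (fun h' => ha (h' ▸ hx)) (h ▸ P.mem_part_self.2 (mem_insert_of_mem hx))
    refine ⟨⟨(P.part a).erase a, P.ofSubset (erase_subset _ _) hsup⟩, by simpa using hsub, ?_⟩
    ext1
    simp [insert_erase haa, insert_erase haP]
  · rintro ⟨t, Q⟩ ht
    simp only [mem_sigma, mem_powerset, mem_univ, and_true] at ht
    simp only [Finpartition.extend_parts]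
    rw [prod_insert (fun h => hn t Q _ h (mem_insert_self a t)),
      card_insert_of_notMem (fun h => ha (ht h))]

/-- Distinguish a point: its block has `k` further elements, chosen in `n.choose k` ways, and by
induction the partitions of the remaining points contribute `m (n - k)`. -/
theorem Finpartition.sum_prod_card_of_recursion {α : Type*} [DecidableEq α] {κ m : ℕ → ℝ}
    (h0 : m 0 = 1)
    (hm : ∀ n, m (n + 1) = ∑ k ∈ range (n + 1), n.choose k * κ (k + 1) * m (n - k))
    (s : Finset α) :
    ∑ P : Finpartition s, ∏ B ∈ P.parts, κ #B = m #s := by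
  induction hs : #s using Nat.strong_induction_on generalizing s with
  | _ n ih =>
    rcases s.eq_empty_or_nonempty with rfl | ⟨a, has⟩
    · obtain rfl : n = 0 := by simpa using hs.symm
      change ∑ P : Finpartition (⊥ : Finset α), _ = _
      rw [Fintype.sum_unique, Finpartition.default_eq_empty]
      simp [h0]
    · obtain ⟨n, rfl⟩ : ∃ k, n = k + 1 := ⟨n - 1, by have := card_pos.2 ⟨a, has⟩; omega⟩
      have hcard : #(s.erase a) = n := by rw [card_erase_of_mem has, hs]; rfl
      rw [← insert_erase has, sum_prod_card_insert κ (notMem_erase a s), hm]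
      have (t) (ht : t ∈ (s.erase a).powerset) :
          κ (#t + 1) * ∑ Q : Finpartition (s.erase a \ t), ∏ B ∈ Q.parts, κ #B =
            κ (#t + 1) * m (n - #t) := by
        have h := card_sdiff_of_subset (mem_powerset.1 ht)
        rw [hcard] at h
        rw [ih (n - #t) (by omega) _ h]
      rw [sum_congr rfl this, sum_powerset_apply_card (fun k => κ (k + 1) * m (n - k)), hcard]
      simp [mul_assoc]

end

/-! ### Counts of compact sets and the mean measure -/

theorem ProbabilityTheory.lintegral_natCast_poissonMeasure (r : ℝ≥0) :
    ∫⁻ k : ℕ, (k : ℝ≥0∞) ∂poissonMeasure r = r := by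
  have hs : HasSum (fun k : ℕ => Real.exp (-r) * r ^ k / k.factorial * k) r := by
    rw [← hasSum_nat_add_iff' 1]
    have h := (hasSum_one_poissonMeasure r).mul_left (r : ℝ)
    simp only [mul_one] at h
    simp only [Finset.range_one, Finset.sum_singleton, Nat.cast_zero, mul_zero, sub_zero]
    convert! h using 2 with k
    rw [Nat.factorial_succ]
    push_cast
    field_simp
    ring
  simp only [poissonMeasure, lintegral_sum_measure, lintegral_smul_measure, lintegral_dirac]
  have h (k : ℕ) : ENNReal.ofReal (Real.exp (-r) * r ^ k / k.factorial) • (k : ℝ≥0∞) =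
      ENNReal.ofReal (Real.exp (-r) * r ^ k / k.factorial * k) := by
    rw [ENNReal.ofReal_mul (by positivity), ENNReal.ofReal_natCast, smul_eq_mul]
  simp_rw [h]
  rw [← ENNReal.ofReal_tsum_of_nonneg (fun k => by positivity) hs.summable, hs.tsum_eq,
    ENNReal.ofReal_coe_nnreal]

theorem ProbabilityTheory.mgf_natCast_poissonMeasure (r : ℝ≥0) (t : ℝ) :
    ∫ k : ℕ, Real.exp (t * k) ∂poissonMeasure r = Real.exp (r * (Real.exp t - 1)) := by
  rw [integral_poissonMeasure]
  have h := (NormedSpace.expSeries_div_hasSum_exp (r * Real.exp t : ℝ)).mul_left (Real.exp (-r))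
  rw [← Real.exp_eq_exp_ℝ, ← Real.exp_add] at h
  convert! h.tsum_eq using 2
  · ext k
    rw [smul_eq_mul, mul_pow, mul_comm t, Real.exp_nat_mul]
    ring
  · ring

namespace PointConfiguration
variable {X : Type*} [TopologicalSpace X] [MeasurableSpace X]

theorem measurable_toMeasure : Measurable (toMeasure : PointConfiguration X → Measure X) :=
  comap_measurable _

end PointConfiguration

open PointConfiguration Filter

namespace IsPoissonMeasure

variable {X : Type*} [TopologicalSpace X] [MeasurableSpace X]
  {σ : Measure X} {π : Measure (PointConfiguration X)}

theorem lintegral_count [IsFiniteMeasureOnCompacts σ] (hπ : IsPoissonMeasure σ π) {A : Set X}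
    (hA : IsCompact A) :
    ∫⁻ ω, ω.toMeasure A ∂π = σ A := by
  have h := (hπ.hasLaw_count A hA).lintegral_comp (f := id) (by fun_prop)
  simp only [id] at h
  rw [h, lintegral_map (by fun_prop) .of_discrete, lintegral_natCast_poissonMeasure,
    ENNReal.coe_toNNReal hA.measure_lt_top.ne]

theorem ae_count_lt_top [OpensMeasurableSpace X] [T2Space X] [IsFiniteMeasureOnCompacts σ]
    (hπ : IsPoissonMeasure σ π) {K : Set X} (hK : IsCompact K) :
    ∀ᵐ ω ∂π, ω.toMeasure K < ∞ := by
  refine ae_lt_top ((Measure.measurable_coe hK.measurableSet).comp measurable_toMeasure) ?_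
  rw [hπ.lintegral_count hK]
  exact hK.measure_lt_top.ne

theorem mgf_count (hπ : IsPoissonMeasure σ π) {A : Set X} (hA : IsCompact A) (t : ℝ) :
    mgf (fun ω : PointConfiguration X => (ω.toMeasure A).toReal) π t =
      Real.exp (σ.real A * (Real.exp t - 1)) := by
  have hm : Measurable fun x : ℝ≥0∞ => Real.exp (t * x.toReal) := by fun_prop
  have h := (hπ.hasLaw_count A hA).integral_comp hm.aestronglyMeasurable
  rw [integral_map (by fun_prop) hm.aestronglyMeasurable] at h
  simp only [ENNReal.toReal_natCast] at h
  rw [mgf_natCast_poissonMeasure] at h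
  exact h

theorem integrable_exp_count (hπ : IsPoissonMeasure σ π) {K : Set X} (hK : IsCompact K) (t : ℝ) :
    Integrable (fun ω => Real.exp (t * (ω.toMeasure K).toReal)) π := by
  -- The Bochner integral of a non-integrable function is 0, while the value found for the mgf is
  -- positive.
  by_contra h
  have h' := hπ.mgf_count hK t
  rw [mgf, integral_undef h] at h'
  exact (Real.exp_pos _).ne h'

/-- Both measures agree on compact sets, which determine them by inner regularity. This is what
turns a `σ`-null set into an `ω`-null set for almost every `ω`. -/
theorem bind_toMeasure {X : Type*} [MetricSpace X] [SigmaCompactSpace X] [MeasurableSpace X]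
    [BorelSpace X] {σ : Measure X} [SigmaFinite σ] [IsFiniteMeasureOnCompacts σ]
    {π : Measure (PointConfiguration X)} (hπ : IsPoissonMeasure σ π) :
    π.bind toMeasure = σ := by
  have hK (A : Set X) (hA : IsCompact A) : π.bind toMeasure A = σ A := by
    rw [Measure.bind_apply hA.measurableSet measurable_toMeasure.aemeasurable,
      hπ.lintegral_count hA]
  have : SigmaFinite (π.bind toMeasure) := by
    refine ⟨⟨⟨compactCovering X, fun _ => trivial, fun n => ?_, iUnion_compactCovering X⟩⟩⟩
    rw [hK _ (isCompact_compactCovering X n)]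
    exact (isCompact_compactCovering X n).measure_lt_top
  ext B hB
  rw [hB.measure_eq_iSup_isCompact, hB.measure_eq_iSup_isCompact]
  exact iSup_congr fun K => iSup_congr fun _ => iSup_congr fun hc => hK K hc

end IsPoissonMeasure

/-! ### The Laplace functional -/

theorem Finset.apply_sum_indicator_of_pairwise_disjoint {ι X M N : Type*} [Fintype ι]
    [AddCommMonoid M] [AddCommMonoid N] {A : ι → Set X}
    (hA : Pairwise fun i j => Disjoint (A i) (A j)) {h : M → N} (h0 : h 0 = 0) (c : ι → M) (x : X) :
    h (∑ i, (A i).indicator (fun _ => c i) x) = ∑ i, (A i).indicator (fun _ => h (c i)) x := by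
  by_cases hx : ∃ i, x ∈ A i
  · obtain ⟨i, hi⟩ := hx
    have hn (j : ι) (hj : j ≠ i) : x ∉ A j := fun h => Set.disjoint_left.1 (hA hj) h hi
    rw [Finset.sum_eq_single_of_mem i (Finset.mem_univ i),
      Finset.sum_eq_single_of_mem i (Finset.mem_univ i)]
    · simp [hi]
    · intro j _ hj; simp [hn j hj]
    · intro j _ hj; simp [hn j hj]
  · push Not at hx
    simp [hx, h0]

theorem MeasureTheory.integrable_of_abs_le_indicator {X : Type*} [MeasurableSpace X] {μ : Measure X}
    {K : Set X} (hK : MeasurableSet K) (hμ : μ K < ∞) {f : X → ℝ} (hf : AEStronglyMeasurable f μ) {C : ℝ}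
    (hfC : ∀ x, |f x| ≤ K.indicator (fun _ => C) x) : Integrable f μ :=
  Integrable.mono' ((integrable_indicator_iff hK).2 (integrableOn_const hμ.ne)) hf
    (Eventually.of_forall hfC)

theorem Real.abs_exp_sub_one_le_indicator {X : Type*} {K : Set X} {f : X → ℝ} {C : ℝ}
    (hfC : ∀ x, |f x| ≤ K.indicator (fun _ => C) x) (x : X) :
    |Real.exp (f x) - 1| ≤ K.indicator (fun _ => Real.exp C + 1) x := by
  have h := hfC x
  by_cases hx : x ∈ K
  · simp only [hx, Set.indicator_of_mem] at h ⊢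
    calc |Real.exp (f x) - 1| ≤ |Real.exp (f x)| + |1| := abs_sub _ _
      _ ≤ _ := by
        rw [Real.abs_exp, abs_one]
        gcongr
        exact (le_abs_self _).trans h
  · simp only [hx, Set.indicator_of_notMem, not_false_eq_true, abs_nonpos_iff] at h ⊢
    simp [h]

namespace IsPoissonMeasure

variable {X : Type*} [MetricSpace X] [MeasurableSpace X] [BorelSpace X] {σ : Measure X}
  [IsFiniteMeasureOnCompacts σ] {π : Measure (PointConfiguration X)}

theorem aemeasurable_integral (hπ : IsPoissonMeasure σ π) {K : Set X} (hK : IsCompact K)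
    {f : X → ℝ} (hf : Measurable f) {C : ℝ} (hfC : ∀ x, |f x| ≤ K.indicator (fun _ => C) x) :
    AEMeasurable (fun ω => ∫ x, f x ∂ω.toMeasure) π := by
  have h1 (g : X → ℝ) (hg : Measurable g) : Measurable fun ω : PointConfiguration X =>
      (∫⁻ x, ENNReal.ofReal (g x) ∂ω.toMeasure).toReal :=
    ((Measure.measurable_lintegral hg.ennreal_ofReal).comp measurable_toMeasure).ennreal_toReal
  refine ⟨_, (h1 f hf).sub (h1 (fun x => -f x) hf.neg), ?_⟩
  filter_upwards [hπ.ae_count_lt_top hK] with ω hω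
  exact integral_eq_lintegral_pos_part_sub_lintegral_neg_part
    (integrable_of_abs_le_indicator hK.measurableSet hω hf.aestronglyMeasurable hfC)

theorem ae_abs_integral_le (hπ : IsPoissonMeasure σ π) {K : Set X} (hK : IsCompact K)
    {f : X → ℝ} {C : ℝ} (hfC : ∀ x, |f x| ≤ K.indicator (fun _ => C) x) :
    ∀ᵐ ω ∂π, |∫ x, f x ∂ω.toMeasure| ≤ C * (ω.toMeasure K).toReal := by
  filter_upwards [hπ.ae_count_lt_top hK] with ω hω
  have h := norm_integral_le_of_norm_le (μ := ω.toMeasure)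
    ((integrable_indicator_iff hK.measurableSet).2 (integrableOn_const hω.ne))
    (Eventually.of_forall hfC : ∀ᵐ x ∂ω.toMeasure, ‖f x‖ ≤ _)
  rwa [integral_indicator_const _ hK.measurableSet, smul_eq_mul, mul_comm] at h

theorem integrable_exp_integral (hπ : IsPoissonMeasure σ π) {K : Set X} (hK : IsCompact K)
    {f : X → ℝ} (hf : Measurable f) {C : ℝ} (hfC : ∀ x, |f x| ≤ K.indicator (fun _ => C) x) :
    Integrable (fun ω => Real.exp (∫ x, f x ∂ω.toMeasure)) π := by
  refine Integrable.mono' (hπ.integrable_exp_count hK C)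
    (hπ.aemeasurable_integral hK hf hfC).exp.aestronglyMeasurable ?_
  filter_upwards [hπ.ae_abs_integral_le hK hfC] with ω hω
  rw [Real.norm_eq_abs, Real.abs_exp]
  exact Real.exp_le_exp.2 ((le_abs_self _).trans hω)

theorem laplace_sum_indicator (hπ : IsPoissonMeasure σ π) {ι : Type*} [Fintype ι] {A : ι → Set X}
    (hA : ∀ i, IsCompact (A i)) (hd : Pairwise fun i j => Disjoint (A i) (A j)) (c : ι → ℝ) :
    ∫ ω, Real.exp (∫ x, ∑ i, (A i).indicator (fun _ => c i) x ∂ω.toMeasure) ∂π =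
      Real.exp (∫ x, (Real.exp (∑ i, (A i).indicator (fun _ => c i) x) - 1) ∂σ) := by
  have hsum {μ : Measure X} (hμ : ∀ i, μ (A i) < ∞) (c : ι → ℝ) :
      ∫ x, ∑ i, (A i).indicator (fun _ => c i) x ∂μ = ∑ i, c i * μ.real (A i) := by
    rw [integral_finsetSum _ fun i _ => (integrable_indicator_iff (hA i).measurableSet).2
      (integrableOn_const (hμ i).ne)]
    simp [integral_indicator_const _ (hA _).measurableSet, mul_comm]
  let e := Fintype.equivFin ι
  have hind : iIndepFun (fun i (ω : PointConfiguration X) => ω.toMeasure (A i)) π := by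
    have h := hπ.iIndepFun_count _ (fun k => A (e.symm k)) (fun k => hA _)
      (fun k l hkl => hd (e.symm.injective.ne hkl))
    simpa using h.precomp e.injective
  have hind' := hind.comp (fun i x => c i * x.toReal) (fun i => by fun_prop)
  have hm (i : ι) : Measurable fun ω : PointConfiguration X => ω.toMeasure (A i) :=
    (Measure.measurable_coe (hA i).measurableSet).comp measurable_toMeasure
  have hprod := hind'.mgf_sum (t := 1) (fun i => by
    have := hm i
    fun_prop) Finset.univ
  have hleft : ∫ ω, Real.exp (∫ x, ∑ i, (A i).indicator (fun _ => c i) x ∂ω.toMeasure) ∂π =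
      mgf (∑ i, (fun x : ℝ≥0∞ => c i * x.toReal) ∘
        fun ω : PointConfiguration X => ω.toMeasure (A i)) π 1 := by
    refine integral_congr_ae ?_
    filter_upwards [ae_all_iff.2 fun i => hπ.ae_count_lt_top (hA i)] with ω hω
    simp [hsum hω, Measure.real]
  rw [hleft, hprod]
  simp_rw [Finset.apply_sum_indicator_of_pairwise_disjoint hd
    (h := fun y => Real.exp y - 1) (by simp) c]
  rw [hsum fun i => (hA i).measure_lt_top, Real.exp_sum]
  refine Finset.prod_congr rfl fun i _ => ?_
  have := hπ.mgf_count (hA i) (c i)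
  rw [mul_comm, ← this]
  simp [mgf]

variable [SigmaCompactSpace X] [SigmaFinite σ]

theorem ae_ae (hπ : IsPoissonMeasure σ π) {p : X → Prop} (hp : ∀ᵐ x ∂σ, p x) :
    ∀ᵐ ω ∂π, ∀ᵐ x ∂ω.toMeasure, p x := by
  rw [← hπ.bind_toMeasure] at hp
  exact Measure.ae_ae_of_ae_bind measurable_toMeasure.aemeasurable hp

/-- The Laplace functional identity passes to limits that are uniformly bounded and supported in
a fixed compact set. -/
theorem laplace_of_tendsto (hπ : IsPoissonMeasure σ π) {K : Set X} (hK : IsCompact K)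
    {F : ℕ → X → ℝ} {f : X → ℝ} (hF : ∀ j, Measurable (F j)) {C : ℝ}
    (hFC : ∀ j x, |F j x| ≤ K.indicator (fun _ => C) x)
    (hlim : ∀ᵐ x ∂σ, Tendsto (fun j => F j x) atTop (𝓝 (f x)))
    (h : ∀ j, ∫ ω, Real.exp (∫ x, F j x ∂ω.toMeasure) ∂π =
      Real.exp (∫ x, (Real.exp (F j x) - 1) ∂σ)) :
    ∫ ω, Real.exp (∫ x, f x ∂ω.toMeasure) ∂π = Real.exp (∫ x, (Real.exp (f x) - 1) ∂σ) := by
  have hint (c : ℝ) {μ : Measure X} (hμ : μ K < ∞) : Integrable (K.indicator fun _ => c) μ :=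
    (integrable_indicator_iff hK.measurableSet).2 (integrableOn_const hμ.ne)
  have h1 : Tendsto (fun j => ∫ ω, Real.exp (∫ x, F j x ∂ω.toMeasure) ∂π) atTop
      (𝓝 (∫ ω, Real.exp (∫ x, f x ∂ω.toMeasure) ∂π)) := by
    refine tendsto_integral_of_dominated_convergence
      (fun ω => Real.exp (C * (ω.toMeasure K).toReal))
      (fun j => (hπ.aemeasurable_integral hK (hF j) (hFC j)).exp.aestronglyMeasurable)
      (hπ.integrable_exp_count hK C) (fun j => ?_) ?_
    · filter_upwards [hπ.ae_abs_integral_le hK (hFC j)] with ω hω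
      rw [Real.norm_eq_abs, Real.abs_exp]
      exact Real.exp_le_exp.2 ((le_abs_self _).trans hω)
    -- For almost every `ω`, `ω(K)` is finite and the convergence also holds `ω`-almost everywhere,
    -- so dominated convergence applies under `ω` as well.
    · filter_upwards [hπ.ae_count_lt_top hK, hπ.ae_ae hlim] with ω hω hlimω
      exact (Real.continuous_exp.tendsto _).comp (tendsto_integral_of_dominated_convergence _
        (fun j => (hF j).aestronglyMeasurable) (hint C hω)
        (fun j => Eventually.of_forall (hFC j)) hlimω)
  have h2 : Tendsto (fun j => Real.exp (∫ x, (Real.exp (F j x) - 1) ∂σ)) atTop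
      (𝓝 (Real.exp (∫ x, (Real.exp (f x) - 1) ∂σ))) := by
    refine (Real.continuous_exp.tendsto _).comp (tendsto_integral_of_dominated_convergence _
      (fun j => ((hF j).exp.sub_const 1).aestronglyMeasurable)
      (hint (Real.exp C + 1) hK.measure_lt_top)
      (fun j => Eventually.of_forall (Real.abs_exp_sub_one_le_indicator (hFC j))) ?_)
    filter_upwards [hlim] with x hx
    exact ((Real.continuous_exp.tendsto _).comp hx).sub_const 1
  exact tendsto_nhds_unique (h1.congr h) h2

end IsPoissonMeasure

/-- A measurable set of finite measure is exhausted, up to a null set, by an increasing sequence of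
compact subsets. -/
theorem MeasurableSet.exists_monotone_isCompact {X : Type*} [TopologicalSpace X] [T2Space X]
    [MeasurableSpace X] [OpensMeasurableSpace X] {μ : Measure X} [μ.InnerRegularCompactLTTop]
    {B : Set X} (hB : MeasurableSet B) (hμB : μ B ≠ ∞) :
    ∃ A : ℕ → Set X, Monotone A ∧ (∀ j, IsCompact (A j)) ∧ (∀ j, A j ⊆ B) ∧
      μ (B \ ⋃ j, A j) = 0 := by
  -- At `j = 0` the tolerance is `∞`, which is still nonzero as required.
  have h (j : ℕ) := hB.exists_isCompact_sdiff_lt hμB (ε := (j : ℝ≥0∞)⁻¹) (by simp)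
  choose L hLB hL hμL using h
  refine ⟨Set.accumulate L, Set.monotone_accumulate, fun j => ?_, fun j => ?_, ?_⟩
  · exact (Set.finite_Iic j).isCompact_biUnion fun i _ => hL i
  · exact Set.iUnion₂_subset fun i _ => hLB i
  · rw [Set.iUnion_accumulate]
    refine le_antisymm (ge_of_tendsto' ENNReal.tendsto_inv_nat_nhds_zero fun j => ?_) zero_le
    exact (measure_mono (Set.sdiff_subset_sdiff_right (Set.subset_iUnion L j))).trans (hμL j).le

namespace IsPoissonMeasure

variable {X : Type*} [MetricSpace X] [SigmaCompactSpace X] [MeasurableSpace X]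
  [BorelSpace X] {σ : Measure X} [SigmaFinite σ] [IsFiniteMeasureOnCompacts σ]
  {π : Measure (PointConfiguration X)}

/-- Independence is given only for compact sets, so each level set of `g` in `K` is exhausted from
inside by compact sets, up to a `σ`-null set. -/
theorem laplace_indicator_simpleFunc (hπ : IsPoissonMeasure σ π) {K : Set X} (hK : IsCompact K)
    (g : SimpleFunc X ℝ) :
    ∫ ω, Real.exp (∫ x, K.indicator g x ∂ω.toMeasure) ∂π =
      Real.exp (∫ x, (Real.exp (K.indicator g x) - 1) ∂σ) := by
  have hB (y : ℝ) : MeasurableSet (g ⁻¹' {y} ∩ K) :=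
    (g.measurableSet_fiber y).inter hK.measurableSet
  have hBfin (y : ℝ) : σ (g ⁻¹' {y} ∩ K) ≠ ∞ :=
    ((measure_mono Set.inter_subset_right).trans_lt hK.measure_lt_top).ne
  choose A hmono hcomp hsub hnull using fun y => (hB y).exists_monotone_isCompact (hBfin y)
  have hd (j : ℕ) : Pairwise fun y z : g.range => Disjoint (A y j) (A z j) := by
    intro y z hyz
    refine Set.disjoint_left.2 fun x hy hz => hyz (Subtype.ext ?_)
    exact (hsub y j hy).1.symm.trans (hsub z j hz).1
  have hval (j : ℕ) (x : X) : ∑ y : g.range, (A y j).indicator (fun _ => (y : ℝ)) x =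
      (A (g x) j).indicator g x := by
    rw [Finset.sum_eq_single_of_mem ⟨g x, g.mem_range_self x⟩ (Finset.mem_univ _)]
    · rfl
    · intro y _ hy
      refine Set.indicator_of_notMem (fun h => hy (Subtype.ext (hsub y j h).1.symm)) _
  obtain ⟨C, hC⟩ := g.exists_forall_norm_le
  refine hπ.laplace_of_tendsto hK
    (F := fun j x => ∑ y : g.range, (A y j).indicator (fun _ => (y : ℝ)) x) (C := C)
    (fun j => Finset.measurable_sum _ fun y _ =>
      measurable_const.indicator (hcomp y j).measurableSet) ?_ ?_
    (fun j => hπ.laplace_sum_indicator (A := fun y : g.range => A y j)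
      (fun y => hcomp y j) (hd j) _)
  · intro j x
    rw [hval]
    by_cases hx : x ∈ A (g x) j
    · rw [Set.indicator_of_mem hx, Set.indicator_of_mem (hsub _ j hx).2]
      exact hC x
    · rw [Set.indicator_of_notMem hx, abs_zero]
      exact Set.indicator_nonneg (fun _ _ => (norm_nonneg _).trans (hC x)) x
  · simp_rw [hval]
    have hae : ∀ᵐ x ∂σ, ∀ y : g.range, x ∉ (g ⁻¹' {(y : ℝ)} ∩ K) \ ⋃ j, A y j :=
      ae_all_iff.2 fun y => measure_eq_zero_iff_ae_notMem.1 (hnull y)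
    filter_upwards [hae] with x hx
    have hx := hx ⟨g x, g.mem_range_self x⟩
    by_cases hxK : x ∈ K
    · have : ∃ j, x ∈ A (g x) j := by simpa [hxK] using hx
      obtain ⟨j₀, hj₀⟩ := this
      refine tendsto_const_nhds.congr' ?_
      filter_upwards [eventually_ge_atTop j₀] with j hj
      rw [Set.indicator_of_mem hxK, Set.indicator_of_mem (hmono _ hj hj₀)]
    · have (j : ℕ) : x ∉ A (g x) j := fun h => hxK (hsub _ j h).2
      simp [this, hxK]

/-- The Laplace functional of a Poisson measure, for bounded functions with compact support. -/
theorem laplace (hπ : IsPoissonMeasure σ π) {K : Set X} (hK : IsCompact K) {f : X → ℝ}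
    (hf : Measurable f) {C : ℝ} (hfC : ∀ x, |f x| ≤ K.indicator (fun _ => C) x) :
    ∫ ω, Real.exp (∫ x, f x ∂ω.toMeasure) ∂π = Real.exp (∫ x, (Real.exp (f x) - 1) ∂σ) := by
  have hfC' (x : X) : ‖f x‖ ≤ |C| := (hfC x).trans
    (Set.indicator_apply_le' (fun _ => le_abs_self C) (fun _ => abs_nonneg C))
  have hfK (x : X) (hx : x ∉ K) : f x = 0 := by simpa [hx] using hfC x
  have hs := hf.stronglyMeasurable
  refine hπ.laplace_of_tendsto hK (F := fun j => K.indicator (hs.approxBounded |C| j)) (C := |C|)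
    (fun j => (hs.approxBounded |C| j).measurable.indicator hK.measurableSet)
    (fun j x => ?_) (Eventually.of_forall fun x => ?_)
    (fun j => hπ.laplace_indicator_simpleFunc hK _)
  · by_cases hx : x ∈ K
    · simpa [hx] using hs.norm_approxBounded_le (abs_nonneg C) j x
    · simp [hx]
  · by_cases hx : x ∈ K
    · simpa [hx] using hs.tendsto_approxBounded_of_norm_le (hfC' x)
    · simp [hx, hfK x hx]

end IsPoissonMeasure

/-! ### Cumulants and moments -/

open scoped ContDiff in
/-- Faà di Bruno's formula for `exp ∘ G` at a zero of `G`. -/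
theorem iteratedDeriv_exp_comp {α : Type*} [DecidableEq α] {G : ℝ → ℝ} (hG : ContDiff ℝ ∞ G)
    {x : ℝ} (hx : G x = 0) (s : Finset α) :
    iteratedDeriv s.card (fun t => Real.exp (G t)) x =
      ∑ P : Finpartition s, ∏ B ∈ P.parts, iteratedDeriv B.card G x := by
  symm
  refine Finpartition.sum_prod_card_of_recursion (κ := fun k => iteratedDeriv k G x)
    (m := fun k => iteratedDeriv k (fun t => Real.exp (G t)) x) (by simp [hx]) (fun n => ?_) s
  -- The Leibniz rule applied to this product is exactly the recursion required.
  have hd : deriv (fun t => Real.exp (G t)) = fun t => deriv G t * Real.exp (G t) := by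
    ext t
    rw [_root_.deriv_exp (hG.differentiable (by simp) t), mul_comm]
  have hG' : ContDiff ℝ ∞ (deriv G) := (contDiff_infty_iff_deriv.1 hG).2
  simp only [iteratedDeriv_succ', hd]
  exact iteratedDeriv_fun_mul (hG'.contDiffAt.of_le (by exact_mod_cast le_top))
    (hG.exp.contDiffAt.of_le (by exact_mod_cast le_top))

theorem iteratedDeriv_add_two_sub_const_sub_mul_const {g : ℝ → ℝ} (hg : Differentiable ℝ g)
    (a b : ℝ) (k : ℕ) :
    iteratedDeriv (k + 2) (fun t => g t - a - t * b) = iteratedDeriv (k + 2) g := by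
  have h : deriv (fun t => g t - a - t * b) = fun t => deriv g t - b := by
    ext t
    exact (((hg t).hasDerivAt.sub_const a).sub (by simpa using (hasDerivAt_id t).mul_const b)).deriv
  rw [iteratedDeriv_succ', h, iteratedDeriv_succ', iteratedDeriv_succ', iteratedDeriv_succ']
  congr 1
  ext t
  exact deriv_sub_const ..

theorem Finpartition.sum_prod_card_eq_sum_filter {α R : Type*} [DecidableEq α] [CommSemiring R]
    {κ κ' : ℕ → R} (h1 : κ 1 = 0) (h2 : ∀ k, 2 ≤ k → κ k = κ' k) (s : Finset α) :
    ∑ P : Finpartition s, ∏ B ∈ P.parts, κ B.card =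
      ∑ P : Finpartition s with ∀ B ∈ P.parts, 2 ≤ B.card, ∏ B ∈ P.parts, κ' B.card := by
  rw [Finset.sum_filter]
  refine Finset.sum_congr rfl fun P _ => ?_
  split_ifs with h
  · exact Finset.prod_congr rfl fun B hB => h2 _ (h B hB)
  · push Not at h
    obtain ⟨B, hB, hB2⟩ := h
    have := (P.nonempty_of_mem_parts hB).card_pos
    exact Finset.prod_eq_zero hB (by rwa [show B.card = 1 by omega])

theorem Real.abs_const_mul_le_indicator {X : Type*} {K : Set X} {f : X → ℝ} {C : ℝ}
    (hfC : ∀ x, |f x| ≤ K.indicator (fun _ => C) x) (t : ℝ) (x : X) :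
    |t * f x| ≤ K.indicator (fun _ => |t| * C) x := by
  rw [abs_mul]
  have h := mul_le_mul_of_nonneg_left (hfC x) (abs_nonneg t)
  by_cases hx : x ∈ K <;> simpa [hx] using h

theorem Real.abs_le_abs_of_abs_le_indicator {X : Type*} {K : Set X} {f : X → ℝ} {C : ℝ}
    (hfC : ∀ x, |f x| ≤ K.indicator (fun _ => C) x) (x : X) : |f x| ≤ |C| :=
  (hfC x).trans (Set.indicator_apply_le' (fun _ => le_abs_self C) (fun _ => abs_nonneg C))

namespace IsPoissonMeasure

variable {X : Type*} [MetricSpace X] [SigmaCompactSpace X] [MeasurableSpace X]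
  [BorelSpace X] {σ : Measure X} [SigmaFinite σ] [IsFiniteMeasureOnCompacts σ]
  {π : Measure (PointConfiguration X)}

theorem integrable_exp_compensatedIntegral (hπ : IsPoissonMeasure σ π) {K : Set X}
    (hK : IsCompact K) {f : X → ℝ} (hf : Measurable f) {C : ℝ}
    (hfC : ∀ x, |f x| ≤ K.indicator (fun _ => C) x) (t : ℝ) :
    Integrable (fun ω => Real.exp (t * compensatedIntegral σ f ω)) π := by
  have htfC := Real.abs_const_mul_le_indicator hfC t
  refine ((hπ.integrable_exp_integral hK (hf.const_mul t) htfC).mul_const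
    (Real.exp (-(t * ∫ x, f x ∂σ)))).congr (Eventually.of_forall fun ω => ?_)
  simp only [compensatedIntegral, integral_const_mul, ← Real.exp_add]
  ring_nf

theorem mgf_compensatedIntegral (hπ : IsPoissonMeasure σ π) {K : Set X}
    (hK : IsCompact K) {f : X → ℝ} (hf : Measurable f) {C : ℝ}
    (hfC : ∀ x, |f x| ≤ K.indicator (fun _ => C) x) (t : ℝ) :
    mgf (compensatedIntegral σ f) π t =
      Real.exp (mgf f (σ.restrict K) t - σ.real K - t * ∫ x, f x ∂σ) := by
  have htfC := Real.abs_const_mul_le_indicator hfC t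
  have h := hπ.laplace hK (hf.const_mul t) htfC
  -- Splitting off the constant 1 needs a finite measure; the integrand vanishes off `K`, so
  -- restricting to `K` is harmless.
  have hK' : ∫ x, (Real.exp (t * f x) - 1) ∂σ = mgf f (σ.restrict K) t - σ.real K := by
    have hfK (x : X) (hx : x ∉ K) : f x = 0 := by simpa [hx] using hfC x
    have : IsFiniteMeasure (σ.restrict K) := isFiniteMeasure_restrict.2 hK.measure_lt_top.ne
    rw [← setIntegral_eq_integral_of_forall_compl_eq_zero (s := K)
      (fun x hx => by simp [hfK x hx]), integral_sub ?_ (integrable_const 1)]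
    · simp [mgf]
    · exact integrable_exp_mul_of_mem_Icc (a := -|C|) (b := |C|) hf.aemeasurable
        (Eventually.of_forall fun x => abs_le.1 (Real.abs_le_abs_of_abs_le_indicator hfC x))
  rw [hK'] at h
  rw [Real.exp_sub, ← h, mgf, ← integral_div]
  simp only [compensatedIntegral, integral_const_mul, ← Real.exp_sub, mul_sub]

end IsPoissonMeasure

theorem proposition3p3 {X : Type*} [MetricSpace X] [SigmaCompactSpace X]
    [MeasurableSpace X] [BorelSpace X]
    (σ : Measure X) [SigmaFinite σ] [IsFiniteMeasureOnCompacts σ] [NullSingletonClass σ]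
    (π : Measure (PointConfiguration X)) (hπ : IsPoissonMeasure σ π)
    (f : X → ℝ) (hf_meas : Measurable f) (hf_bdd : ∃ C : ℝ, ∀ x, |f x| ≤ C)
    (hf_supp : HasCompactSupport f) (n : ℕ) (hn : 1 ≤ n) :
    Integrable (fun ω => PointConfiguration.compensatedIntegral σ f ω ^ n) π ∧
    ∫ ω, PointConfiguration.compensatedIntegral σ f ω ^ n ∂π =
      ∑ P : Finpartition (Finset.Icc 1 n) with ∀ B ∈ P.parts, 2 ≤ B.card,
        ∏ B ∈ P.parts, ∫ x, f x ^ B.card ∂σ := by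
  obtain ⟨C, hC⟩ := hf_bdd
  have hK : IsCompact (tsupport f) := hf_supp
  set K := tsupport f
  have hfK (x : X) (hx : x ∉ K) : f x = 0 := image_eq_zero_of_notMem_tsupport hx
  have hfC (x : X) : |f x| ≤ K.indicator (fun _ => C) x := by
    by_cases hx : x ∈ K
    · simpa [hx] using hC x
    · simp [hx, hfK x hx]
  have : IsFiniteMeasure (σ.restrict K) := isFiniteMeasure_restrict.2 hK.measure_lt_top.ne
  -- The case `k = 0` is excluded because `0 ^ 0 = 1` off `K`.
  have hset (k : ℕ) (hk : k ≠ 0) : ∫ x in K, f x ^ k ∂σ = ∫ x, f x ^ k ∂σ :=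
    setIntegral_eq_integral_of_forall_compl_eq_zero fun x hx => by simp [hfK x hx, hk]
  have hexpS : integrableExpSet (compensatedIntegral σ f) π = Set.univ :=
    Set.eq_univ_of_forall fun t => hπ.integrable_exp_compensatedIntegral hK hf_meas hfC t
  have hexpf : integrableExpSet f (σ.restrict K) = Set.univ :=
    Set.eq_univ_of_forall fun t => integrable_exp_mul_of_mem_Icc (a := -C) (b := C)
      hf_meas.aemeasurable (Eventually.of_forall fun x => abs_le.1 (hC x))
  refine ⟨integrable_pow_of_mem_interior_integrableExpSet (by simp [hexpS]) n, ?_⟩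
  have hmgf : mgf (compensatedIntegral σ f) π = fun t =>
      Real.exp (mgf f (σ.restrict K) t - σ.real K - t * ∫ x, f x ∂σ) :=
    funext fun t => hπ.mgf_compensatedIntegral hK hf_meas hfC t
  have hsmooth : ContDiff ℝ (⊤ : ℕ∞) (mgf f (σ.restrict K)) :=
    contDiff_iff_contDiffAt.2 fun t => (analyticAt_mgf (by simp [hexpf])).contDiffAt
  have hmoment := iteratedDeriv_mgf_zero (X := compensatedIntegral σ f) (μ := π)
    (by simp [hexpS]) n
  have hfaa := iteratedDeriv_exp_comp (α := ℕ)
    (G := fun t => mgf f (σ.restrict K) t - σ.real K - t * ∫ x, f x ∂σ)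
    ((hsmooth.sub contDiff_const).sub (contDiff_id.mul contDiff_const)) (x := 0) (by simp)
    (Finset.Icc 1 n)
  rw [Nat.card_Icc, Nat.add_sub_cancel, ← hmgf, hmoment] at hfaa
  refine Eq.trans (by simp) (hfaa.trans (Finpartition.sum_prod_card_eq_sum_filter
    (κ := fun k => iteratedDeriv k
      (fun t => mgf f (σ.restrict K) t - σ.real K - t * ∫ x, f x ∂σ) 0)
    (κ' := fun k => ∫ x, f x ^ k ∂σ) ?_ ?_ _))
  -- First cumulant: the derivative of the mgf at 0 is `∫ f dσ`, which the compensator cancels.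
  · have h := hasDerivAt_mgf (X := f) (μ := σ.restrict K) (t := 0) (by simp [hexpf])
    have h1 := hset 1 one_ne_zero
    simp only [pow_one] at h1
    simp only [zero_mul, Real.exp_zero, mul_one, h1] at h
    rw [iteratedDeriv_one]
    have h2 := (h.sub_const (σ.real K)).sub
      ((hasDerivAt_id (0 : ℝ)).mul_const (∫ x, f x ∂σ))
    rw [one_mul, sub_self] at h2
    exact h2.deriv
  -- From order 2 on, the affine correction disappears and the derivatives at 0 are the moments of
  -- `f` over `K`.
  · intro k hk
    obtain ⟨j, rfl⟩ := Nat.exists_eq_add_of_le' hk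
    rw [iteratedDeriv_add_two_sub_const_sub_mul_const (hsmooth.differentiable (by simp)),
      iteratedDeriv_mgf_zero (by simp [hexpf])]
    exact hset (j + 2) (by simp)
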